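/- Let $k,t_L,t_R$ be natural numbers, and let $L,R$ be disjoint sets of $k$ parties each. The parties run a protocol in synchronous rounds on the bipartite network: there is a bidirectional authenticated channel between every party of $L$ and every party of $R$, and no other channel. The setting is authenticated: a public-key infrastructure with ideal, unforgeable digital signatures is available. A protocol prescribes, deterministically, the messages and the output of each party as a function of its input and of the messages it has received so far. Each party $u$ has as input a preference list, i.e. a strict ranking of all parties of the other side; it prefers every one of them to being alone. A party is honest if it never becomes byzantine. A protocol achieves byzantine stable matching (bSM) with respect to $t_L,t_R$ if the following hold in every execution in which at most $t_L$ parties of $L$ and at most $t_R$ parties of $R$ become byzantine (deviate arbitrarily, but without forging signatures of other parties): - Termination: every honest party outputs a party of the other side or "nobody". - Symmetry: if $u,v$ are honest and $u$ outputs $v$, then $v$ outputs $u$. - Stability: there are no honest $u\in L$ and $v\in R$ that are not matched to each other and that both prefer each other to what they output. - Non-competition: if two distinct honest parties output parties $u$ and $v$ respectively, then $u\neq v$. Consider the condition $$(*)\qquad (t_L<k \text{ and } t_R<k)\quad\text{or}\quad (t_L<k/3 \text{ or } t_R<k/3).$$ **Theorem.** (a) If $(*)$ holds, there is a protocol achieving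 bSM with respect to $t_L,t_R$, with all honest parties producing their output within a bounded number of rounds, against every adaptive adversary (one that may choose at any point of the execution which parties to corrupt). (b) If $k\ge 2$ and $(*)$ fails, no protocol achieves bSM with respect to $t_L,t_R$, even against static adversaries only (which fix the corrupted parties at the beginning). In particular, for $k\ge 2$, bSM is solvable in a bipartite authenticated network if and only if $(*)$ holds. -/

import Mathlib

/-- The `n = 2k` parties: `Sum.inl i` are the parties of side `L`, `Sum.inr j` those of side `R`. -/
abbrev Party (k : ℕ) : Type := Fin k ⊕ Fin k

/-- The index of a party within its own side. -/
def Party.idx {k : ℕ} (p : Party k) : Fin k := Sum.elim id id p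

/-- A preference list (a permutation) over the `k` parties of the other side:
`π i` is the index of the party in position `i`, position `0` being the most preferred. -/
abbrev PrefList (k : ℕ) : Type := Equiv.Perm (Fin k)

/-- `π.Prefers q o`: the owner of the list `π` strictly prefers the party `q` of the other side to
the match `o`, where `o = none` means being alone. -/
def PrefList.Prefers {k : ℕ} (π : PrefList k) (q : Party k) : Option (Party k) → Prop
  | none => True
  | some q' => π.symm q.idx < π.symm q'.idx

/-! ### Messages with ideal (unforgeable) signatures -/

/-- Messages: arbitrary data, pairs, and messages signed by a party. Everyone can read a signed
message and check whose signature it bears (public key infrastructure). -/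
inductive Message (P : Type) : Type
  | data (n : ℕ) : Message P
  | pair (a b : Message P) : Message P
  | signed (p : P) (m : Message P) : Message P

/-- The signatures (signer, signed message) that occur in a message. -/
def Message.sigs {P : Type} : Message P → Set (P × Message P)
  | .data _ => ∅
  | .pair a b => a.sigs ∪ b.sigs
  | .signed p m => insert (p, m) m.sigs

/-- Whoever holds the signing keys of the parties in `S` and has seen the messages in `K` can
produce exactly the messages in which every signature is by a party in `S` or is copied from a
message in `K`. -/
def Message.Constructible {P : Type} (S : Set P) (K : Set (Message P)) (m : Message P) : Prop :=
  ∀ s ∈ m.sigs, s.1 ∈ S ∨ ∃ m' ∈ K, s ∈ m'.sigs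

/-! ### Synchronous protocols -/

/-- What a party has received so far: one entry per completed round, oldest first; an entry tells
which message, if any, arrived from each party in that round. -/
abbrev History (k : ℕ) : Type := List (Party k → Option (Message (Party k)))

/-- The messages that occur in a history. -/
def History.received {k : ℕ} (h : History k) : Set (Message (Party k)) :=
  {m | ∃ f ∈ h, ∃ q, f q = some m}

/-- A synchronous (round-based) protocol with digital signatures. What party `p` with input `π`
sends to `q` in the next round, and whether it has output yet (`none`: not yet; `some none`: it
matches with nobody; `some (some q)`: it matches with `q`), are functions of what it has received
so far. A party can sign only in its own name; it may forward the signatures it has received. -/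
structure Protocol (k : ℕ) : Type where
  send : Party k → PrefList k → History k → Party k → Option (Message (Party k))
  output : Party k → PrefList k → History k → Option (Option (Party k))
  send_constructible : ∀ p π h q m, send p π h q = some m →
    m.Constructible {p} (History.received h)

/-- The data of a run: the inputs, the set `byz r` of parties that are byzantine in round `r`, and
the message `sent r p q`, if any, that `p` sends to `q` in round `r`, which `q` receives, knowing
that it comes from `p`, before round `r + 1`. -/
structure Execution (k : ℕ) : Type where
  pref : Party k → PrefList k
  byz : ℕ → Set (Party k)
  sent : ℕ → Party k → Party k → Option (Message (Party k))

namespace Execution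

variable {k : ℕ}

/-- What party `p` has received in the rounds before round `r`. -/
def view (e : Execution k) (p : Party k) (r : ℕ) : History k :=
  (List.range r).map fun r' q => e.sent r' q p

/-- A party is honest if it never becomes byzantine. -/
def Honest (e : Execution k) (p : Party k) : Prop := ∀ r, p ∉ e.byz r

/-- All messages that were sent, up to and including round `r`, by parties which were not
byzantine when sending (channels are authenticated but need not be private). -/
def overheard (e : Execution k) (r : ℕ) : Set (Message (Party k)) :=
  {m | ∃ r' ≤ r, ∃ p, p ∉ e.byz r' ∧ ∃ q, e.sent r' p q = some m}

/-- The messages that, before round `r`, were sent to a party byzantine in round `r` by parties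
which were not byzantine when sending. -/
def receivedByByz (e : Execution k) (r : ℕ) : Set (Message (Party k)) :=
  {m | ∃ r' < r, ∃ p, p ∉ e.byz r' ∧ ∃ q ∈ e.byz r, e.sent r' p q = some m}

/-- `e` is a run of the protocol `P` on the network `G` under an adaptive adversary: the adversary
may corrupt parties in every round, permanently; messages travel along edges only; parties that are
not (yet) byzantine follow the protocol; byzantine parties jointly send arbitrary messages, chosen
after those of the other parties in the same round, but cannot forge signatures. -/
structure IsRun (G : SimpleGraph (Party k)) (P : Protocol k) (e : Execution k) : Prop where
  byz_mono : Monotone e.byz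
  channel : ∀ r p q, ¬ G.Adj p q → e.sent r p q = none
  follows : ∀ r p q, p ∉ e.byz r → G.Adj p q →
    e.sent r p q = P.send p (e.pref p) (e.view p r) q
  unforgeable : ∀ r p q m, p ∈ e.byz r → e.sent r p q = some m →
    m.Constructible (e.byz r) (e.overheard r)

/-- A run under a static adversary: the byzantine parties are fixed at the beginning. Moreover
they can use only signatures that byzantine parties received in earlier rounds. -/
structure IsStaticRun (G : SimpleGraph (Party k)) (P : Protocol k) (e : Execution k) : Prop
    extends IsRun G P e where
  byz_const : ∀ r, e.byz r = e.byz 0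
  unforgeable_static : ∀ r p q m, p ∈ e.byz r → e.sent r p q = some m →
    m.Constructible (e.byz r) (e.receivedByByz r)

/-- At most `tL` parties of `L` and at most `tR` parties of `R` ever become byzantine. -/
def Bounded (e : Execution k) (tL tR : ℕ) : Prop :=
  {i : Fin k | ∃ r, (Sum.inl i : Party k) ∈ e.byz r}.ncard ≤ tL ∧
  {j : Fin k | ∃ r, (Sum.inr j : Party k) ∈ e.byz r}.ncard ≤ tR

/-- Party `p` outputs `o` after exactly `r` rounds (an output is final: the first one counts). -/
def OutputsAt (P : Protocol k) (e : Execution k) (p : Party k) (r : ℕ) (o : Option (Party k)) :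
    Prop :=
  P.output p (e.pref p) (e.view p r) = some o ∧
    ∀ r' < r, P.output p (e.pref p) (e.view p r') = none

/-- Party `p` outputs `o`. -/
def Outputs (P : Protocol k) (e : Execution k) (p : Party k) (o : Option (Party k)) : Prop :=
  ∃ r, OutputsAt P e p r o

/-- The four requirements of byzantine stable matching. -/
structure IsBSM (P : Protocol k) (e : Execution k) : Prop where
  termination : ∀ p, e.Honest p →
    ∃ o, Outputs P e p o ∧ ∀ q, o = some q → p.isLeft ≠ q.isLeft
  symmetry : ∀ u v, e.Honest u → e.Honest v → Outputs P e u (some v) → Outputs P e v (some u)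
  stability : ∀ (i j : Fin k) (o o' : Option (Party k)),
    e.Honest (Sum.inl i) → e.Honest (Sum.inr j) →
    Outputs P e (Sum.inl i) o → Outputs P e (Sum.inr j) o' →
    ¬ ((e.pref (Sum.inl i)).Prefers (Sum.inr j) o ∧ (e.pref (Sum.inr j)).Prefers (Sum.inl i) o')
  nonCompetition : ∀ p p', e.Honest p → e.Honest p' → p ≠ p' →
    ∀ u v, Outputs P e p (some u) → Outputs P e p' (some v) → u ≠ v

end Execution

/-- Some protocol achieves byzantine stable matching on the authenticated network `G`, within a
bounded number of rounds, against every adaptive adversary that corrupts at most `tL` parties of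
`L` and at most `tR` parties of `R`. -/
def SolvableAdaptive {k : ℕ} (G : SimpleGraph (Party k)) (tL tR : ℕ) : Prop :=
  ∃ (P : Protocol k) (T : ℕ), ∀ e : Execution k, e.IsRun G P → e.Bounded tL tR →
    e.IsBSM P ∧ ∀ p, e.Honest p → ∃ r ≤ T, ∃ o, e.OutputsAt P p r o

/-- Some protocol achieves byzantine stable matching on the authenticated network `G` against every
static adversary that corrupts at most `tL` parties of `L` and at most `tR` parties of `R`. -/
def SolvableStatic {k : ℕ} (G : SimpleGraph (Party k)) (tL tR : ℕ) : Prop :=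
  ∃ P : Protocol k, ∀ e : Execution k, e.IsStaticRun G P → e.Bounded tL tR → e.IsBSM P

/-! Solvability rests on authenticated broadcast in the style of Dolev and Strong, adapted to a
bipartite network. Parties sign and forward the inputs they accept. If both sides contain an honest
party, whatever one honest party knows reaches all others within two rounds, through the other side
if necessary. Requiring `r / 2` signatures at time `r` therefore makes all honest parties accept the
same inputs by time `4 * k` (`accepts_of_accepts`), and each computes the same stable matching from
them.

If one side is entirely byzantine, it may drop the traffic between the honest parties of the other
side, so their vectors of inputs may differ. Symmetry and stability are then vacuous and only
non-competition is at stake. A party matches only if enough of its own side voted for its vector. As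
fewer than a third of that side is byzantine, two quorums share an honest voter
(`agreedInputs_eq_of_confirmed`), so all parties that do match use the same matching. When both
sides have an honest party, the vote always succeeds (`confirmed`).

Impossibility is a splitting argument. If one side can be wholly corrupted and a third of the other
side too, cut the latter into three groups. The byzantine parties show the first group a world where
the second is silent, and the second a world where the first is silent. In each world a mutual first
choice forces a match with the same party `v`, which violates non-competition. Signatures do not
help: no channel joins the two groups, and a silent party's signature is never needed in the
simulated world. -/

/-! ### Existence of stable matchings -/

/-- Every instance of the stable matching problem with complete strict preference lists has a
stable perfect matching. -/
theorem exists_stable_matching {k : ℕ} (A B : Fin k → Equiv.Perm (Fin k)) :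
    ∃ M : Equiv.Perm (Fin k), ∀ i j,
      ¬ ((A i).symm j < (A i).symm (M i) ∧ (B j).symm i < (B j).symm (M.symm j)) := by
  classical
  rcases k with _ | k
  · exact ⟨1, fun i => i.elim0⟩
  -- `r i` is the position in the list of `i` to which `i` is proposing
  let Valid : (Fin (k + 1) → Fin (k + 1)) → Prop := fun r => ∀ i, ∀ x < r i, ∃ i',
    A i' (r i') = A i x ∧ (B (A i x)).symm i' < (B (A i x)).symm i
  -- A valid state with the largest total of positions plays the role of the final state of the
  -- Gale–Shapley algorithm.
  obtain ⟨r, hr, hmax⟩ := Finset.exists_max_image (Finset.univ.filter Valid)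
    (fun r => ∑ i, (r i : ℕ)) ⟨fun _ => 0, by
      simp only [Finset.mem_filter, Finset.mem_univ, true_and]
      intro i x hx
      exact absurd hx (Fin.not_lt_zero x)⟩
  simp only [Finset.mem_filter, Finset.mem_univ, true_and] at hr hmax
  have hinj : Function.Injective fun i => A i (r i) := by
    by_contra hni
    obtain ⟨i, i', heq, hlt⟩ : ∃ i i', A i (r i) = A i' (r i') ∧
        (B (A i (r i))).symm i' < (B (A i (r i))).symm i := by
      simp only [Function.Injective, not_forall] at hni
      obtain ⟨a, b, hab, hne⟩ := hni
      rcases lt_trichotomy ((B (A a (r a))).symm a) ((B (A a (r a))).symm b) with h | h | h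
      · exact ⟨b, a, hab.symm, by simpa only [hab] using h⟩
      · exact absurd ((B _).symm.injective h) hne
      · exact ⟨a, b, hab, h⟩
    have hheld : ∀ x ≤ r i, ∃ i'', A i'' (r i'') = A i x ∧
        (B (A i x)).symm i'' < (B (A i x)).symm i := by
      intro x hx
      rcases hx.lt_or_eq with h | rfl
      · exact hr i x h
      · exact ⟨i', heq.symm, hlt⟩
    -- If the rejected `i` is at the end of its list, everybody on the other side holds a proposal,
    -- so the proposals form a bijection after all. Otherwise `i` can advance by one, against
    -- maximality.
    by_cases hlast : (r i : ℕ) = k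
    · have hsurj : Function.Surjective fun i => A i (r i) := by
        intro j
        obtain ⟨i'', h, -⟩ := hheld ((A i).symm j) (by
          rw [Fin.le_def, hlast]; exact Nat.lt_succ_iff.mp (Fin.is_lt _))
        exact ⟨i'', by simpa using h⟩
      exact hni (Finite.injective_iff_surjective.mpr hsurj)
    · have hk : (r i : ℕ) + 1 < k + 1 := by have := (r i).is_lt; omega
      have hv : Valid (Function.update r i ⟨r i + 1, hk⟩) := by
        have key : ∀ a x, (∃ i'', A i'' (r i'') = A a x ∧
            (B (A a x)).symm i'' < (B (A a x)).symm a) →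
            ∃ i'', A i'' (Function.update r i ⟨r i + 1, hk⟩ i'') = A a x ∧
              (B (A a x)).symm i'' < (B (A a x)).symm a := by
          rintro a x ⟨i'', h1, h2⟩
          -- A rejection justified by `i` itself, which moves away, is now justified by the rival
          -- `i'`, who is preferred to `i` by the same party.
          by_cases h : i'' = i
          · subst h
            have hne : i' ≠ i'' := by rintro rfl; exact lt_irrefl _ hlt
            refine ⟨i', ?_, ?_⟩
            · rw [Function.update_of_ne hne, ← heq, h1]
            · rw [h1] at hlt
              exact hlt.trans h2
          · exact ⟨i'', by rwa [Function.update_of_ne h], h2⟩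
        intro a x hx
        apply key
        by_cases h : a = i
        · subst h
          rw [Function.update_self] at hx
          exact hheld x (by rw [Fin.lt_def] at hx; rw [Fin.le_def]; simp only at hx; omega)
        · rw [Function.update_of_ne h] at hx
          exact hr a x hx
      have hle := hmax _ hv
      have hlt' : ∑ a, (r a : ℕ) < ∑ a, ((Function.update r i ⟨r i + 1, hk⟩ a : Fin (k + 1)) : ℕ) := by
        apply Finset.sum_lt_sum
        · intro a _
          by_cases h : a = i
          · subst h; simp
          · rw [Function.update_of_ne h]
        · exact ⟨i, Finset.mem_univ _, by simp⟩
      omega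
  refine ⟨Equiv.ofBijective _ (Finite.injective_iff_bijective.mp hinj), ?_⟩
  rintro i j ⟨h1, h2⟩
  set M := Equiv.ofBijective _ (Finite.injective_iff_bijective.mp hinj) with hM
  have hMi : M i = A i (r i) := rfl
  rw [hMi, Equiv.symm_apply_apply] at h1
  obtain ⟨i', h3, h4⟩ := hr i _ h1
  rw [Equiv.apply_symm_apply] at h3 h4
  have : M.symm j = i' := by rw [Equiv.symm_apply_eq]; exact h3.symm
  rw [this] at h2
  exact lt_asymm h2 h4

/-! ### Runs of a protocol -/

/-- The bipartite network. -/
abbrev bipartiteNetwork (k : ℕ) : SimpleGraph (Party k) := completeBipartiteGraph (Fin k) (Fin k)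

theorem bipartiteNetwork_adj {k : ℕ} {p q : Party k} :
    (bipartiteNetwork k).Adj p q ↔ p.isLeft ≠ q.isLeft := by
  rcases p with i | i <;> rcases q with j | j <;> simp [bipartiteNetwork]

theorem Party.eq_of_side_of_idx {k : ℕ} {p q : Party k} (h : p.isLeft = q.isLeft)
    (h' : p.idx = q.idx) : p = q := by
  rcases p with i | i <;> rcases q with j | j <;> simp_all [Party.idx]

theorem ncard_side {k : ℕ} (s : Set (Party k)) (b : Bool) :
    {p | p.isLeft = b ∧ p ∈ s}.ncard =
      {i : Fin k | (if b then Sum.inl i else Sum.inr i : Party k) ∈ s}.ncard := by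
  have hinj : Function.Injective fun i : Fin k => (if b then Sum.inl i else Sum.inr i : Party k) := by
    cases b
    · exact Sum.inr_injective
    · exact Sum.inl_injective
  rw [← Set.ncard_image_of_injective _ hinj]
  congr 1
  ext p
  rcases p with i | i <;> cases b <;> simp

namespace Execution

variable {k : ℕ}

@[simp] theorem length_view (e : Execution k) (p : Party k) (r : ℕ) : (e.view p r).length = r := by
  simp [view]

theorem take_view (e : Execution k) (p : Party k) {r' r : ℕ} (h : r' ≤ r) :
    (e.view p r).take r' = e.view p r' := by
  simp [view, ← List.map_take, List.take_range, h]

theorem mem_received_view {e : Execution k} {p : Party k} {r : ℕ} {m : Message (Party k)} :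
    m ∈ (e.view p r).received ↔ ∃ r' < r, ∃ q, e.sent r' q p = some m := by
  simp [History.received, view]

theorem bounded_iff {e : Execution k} {tL tR : ℕ} : e.Bounded tL tR ↔
    ∀ b : Bool, {p : Party k | p.isLeft = b ∧ ¬ e.Honest p}.ncard ≤ if b then tL else tR := by
  have h : ∀ p, ¬ e.Honest p ↔ p ∈ {p | ∃ r, p ∈ e.byz r} := fun p => by simp [Honest]
  simp only [h, ncard_side, Bool.forall_bool, Bounded]
  simpa using and_comm

/-- The signature of an honest party originates from that party: it was once the first to send it. -/
theorem IsRun.exists_origin {P : Protocol k} {e : Execution k} {G : SimpleGraph (Party k)}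
    (he : e.IsRun G P) {p : Party k} (hp : e.Honest p) (x : Message (Party k)) (r : ℕ) :
    ∀ q q' m, e.sent r q q' = some m → (p, x) ∈ m.sigs →
      ∃ r' ≤ r, ∃ q'' m', e.sent r' p q'' = some m' ∧ (p, x) ∈ m'.sigs ∧
        ∀ m'' ∈ (e.view p r').received, (p, x) ∉ m''.sigs := by
  induction r using Nat.strong_induction_on with
  | _ r ih =>
    have hrec : ∀ q, ∀ m ∈ (e.view q r).received, (p, x) ∈ m.sigs →
        ∃ r' ≤ r, ∃ q'' m', e.sent r' p q'' = some m' ∧ (p, x) ∈ m'.sigs ∧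
          ∀ m'' ∈ (e.view p r').received, (p, x) ∉ m''.sigs := by
      intro q m hm hx
      obtain ⟨r', hr', q', hq'⟩ := mem_received_view.mp hm
      obtain ⟨r'', h, h'⟩ := ih r' hr' _ _ _ hq' hx
      exact ⟨r'', h.trans hr'.le, h'⟩
    have hcorrect : ∀ q q' m, q ∉ e.byz r → e.sent r q q' = some m → (p, x) ∈ m.sigs →
        ∃ r' ≤ r, ∃ q'' m', e.sent r' p q'' = some m' ∧ (p, x) ∈ m'.sigs ∧
          ∀ m'' ∈ (e.view p r').received, (p, x) ∉ m''.sigs := by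
      intro q q' m hq hm hx
      have hadj : G.Adj q q' := by
        by_contra h
        simp [he.channel r q q' h] at hm
      have hm' := hm
      rw [he.follows r q q' hq hadj] at hm'
      rcases P.send_constructible _ _ _ _ _ hm' _ hx with h | ⟨m', hm', hx'⟩
      · obtain rfl : p = q := h
        by_cases hold : ∃ m'' ∈ (e.view p r).received, (p, x) ∈ m''.sigs
        · obtain ⟨m'', h1, h2⟩ := hold
          exact hrec p m'' h1 h2
        · push Not at hold
          exact ⟨r, le_rfl, q', m, hm, hx, hold⟩
      · exact hrec q m' hm' hx'
    intro q q' m hm hx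
    by_cases hq : q ∈ e.byz r
    · rcases he.unforgeable r q q' m hq hm _ hx with h | ⟨m', ⟨r', hr', a, ha, b, hab⟩, hx'⟩
      · exact absurd h (hp r)
      -- The adversary may reuse signatures sent in the same round. Their sender is not byzantine
      -- then, so `hcorrect` covers this case without the induction hypothesis.
      · rcases hr'.lt_or_eq with h | rfl
        · obtain ⟨r'', h1, h2⟩ := ih r' h _ _ _ hab hx'
          exact ⟨r'', h1.trans hr', h2⟩
        · exact hcorrect a b m' ha hab hx'
    · exact hcorrect q q' m hq hm hx

theorem IsBSM.stable {P : Protocol k} {e : Execution k} (he : e.IsBSM P) {u v : Party k}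
    (huv : u.isLeft ≠ v.isLeft) (hu : e.Honest u) (hv : e.Honest v) {o o' : Option (Party k)}
    (ho : Outputs P e u o) (ho' : Outputs P e v o') :
    ¬ ((e.pref u).Prefers v o ∧ (e.pref v).Prefers u o') := by
  rcases u with i | i <;> rcases v with j | j
  · simp at huv
  · exact he.stability i j o o' hu hv ho ho'
  · exact fun h => he.stability j i o' o hv hu ho' ho h.symm
  · simp at huv

theorem outputs_congr {P : Protocol k} {e e' : Execution k} {p : Party k}
    (hpref : e.pref p = e'.pref p) (hview : ∀ r, e.view p r = e'.view p r) {o : Option (Party k)}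
    (h : Outputs P e p o) : Outputs P e' p o := by
  obtain ⟨r, h⟩ := h
  refine ⟨r, ?_⟩
  simpa only [OutputsAt, hpref, hview] using h

end Execution

/-! ### Stable matchings of the parties -/

/-- The match of a party in a stable matching with respect to the preferences `V`. -/
noncomputable def partner {k : ℕ} (V : Party k → PrefList k) : Party k → Party k :=
  Sum.elim
    (fun i => .inr ((exists_stable_matching (fun i => V (.inl i)) fun j => V (.inr j)).choose i))
    (fun j => .inl
      ((exists_stable_matching (fun i => V (.inl i)) fun j => V (.inr j)).choose.symm j))

theorem partner_partner {k : ℕ} (V : Party k → PrefList k) (p : Party k) :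
    partner V (partner V p) = p := by
  rcases p with i | j <;> simp [partner]

theorem isLeft_ne_isLeft_partner {k : ℕ} (V : Party k → PrefList k) (p : Party k) :
    p.isLeft ≠ (partner V p).isLeft := by
  rcases p with i | j <;> simp [partner]

theorem partner_stable {k : ℕ} (V : Party k → PrefList k) (i j : Fin k) :
    ¬ ((V (.inl i)).Prefers (.inr j) (some (partner V (.inl i))) ∧
      (V (.inr j)).Prefers (.inl i) (some (partner V (.inr j)))) :=
  (exists_stable_matching (fun i => V (.inl i)) fun j => V (.inr j)).choose_spec i j

/-! ### The protocol -/

/-- The statements that parties sign: `inl (s, v)` says that the input of `s` is `v`; `inr V` is a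
vote for the vector of inputs `V`. -/
abbrev Claim (k : ℕ) : Type := (Party k × PrefList k) ⊕ (Party k → PrefList k)

/-- A claim as a message. -/
noncomputable def Claim.toMessage {k : ℕ} (c : Claim k) : Message (Party k) :=
  .data ((exists_injective_nat (Claim k)).choose c)

theorem Claim.toMessage_injective {k : ℕ} :
    Function.Injective (Claim.toMessage : Claim k → Message (Party k)) := fun _ _ h =>
  (exists_injective_nat (Claim k)).choose_spec (Message.data.inj h)

/-- Several messages as one message. -/
def Message.bundle {P : Type} (l : List (Message P)) : Message P := l.foldr .pair (.data 0)

theorem Message.mem_sigs_bundle {P : Type} {l : List (Message P)} {x : P × Message P} :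
    x ∈ (bundle l).sigs ↔ ∃ m ∈ l, x ∈ m.sigs := by
  induction l with
  | nil => simp [bundle, sigs]
  | cons a l ih =>
    have : (bundle (a :: l)).sigs = a.sigs ∪ (bundle l).sigs := rfl
    simp [this, ih]

namespace History

variable {k : ℕ}

/-- The messages that occur in a history, as a list. -/
noncomputable def receivedList (h : History k) : List (Message (Party k)) :=
  h.flatMap fun f => (Finset.univ : Finset (Party k)).toList.filterMap f

theorem mem_receivedList {h : History k} {m : Message (Party k)} :
    m ∈ h.receivedList ↔ m ∈ h.received := by
  simp [receivedList, received]

/-- The parties whose signatures of the claim `c` have been received. -/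
def signers (h : History k) (c : Claim k) : Set (Party k) :=
  {p | ∃ m ∈ h.received, (p, c.toMessage) ∈ m.sigs}

/-- Party `p` with input `π` accepts `v` as an input of `s`: this is so from the beginning if
`s = p` and `v = π`; otherwise from when the signature of `s` and, at time `r`, those of at least
`r / 2` parties have been received. -/
def Accepts (p : Party k) (π : PrefList k) (h : History k) (s : Party k) (v : PrefList k) : Prop :=
  (s = p ∧ v = π) ∨ ∃ r ≤ h.length, s ∈ signers (h.take r) (.inl (s, v)) ∧
    r ≤ 2 * (signers (h.take r) (.inl (s, v))).ncard

open Classical in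
/-- The inputs of all parties according to `p`. -/
noncomputable def inputs (p : Party k) (π : PrefList k) (h : History k) (s : Party k) :
    PrefList k :=
  -- A sender with no accepted input, or with several, gets the default list `1`; the result thus
  -- depends only on the set of accepted inputs.
  if hv : ∃ v, ∀ w, Accepts p π h s w ↔ w = v then hv.choose else 1

theorem inputs_eq {p : Party k} {π : PrefList k} {h : History k} {s : Party k} {v : PrefList k}
    (hv : ∀ w, Accepts p π h s w ↔ w = v) : inputs p π h s = v := by
  have hex : ∃ v, ∀ w, Accepts p π h s w ↔ w = v := ⟨v, hv⟩
  rw [inputs, dif_pos hex]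
  exact (hv _).mp ((hex.choose_spec _).mpr rfl)

theorem inputs_congr {p p' : Party k} {π π' : PrefList k} {h h' : History k} {s : Party k}
    (hs : ∀ v, Accepts p π h s v ↔ Accepts p' π' h' s v) : inputs p π h s = inputs p' π' h' s := by
  by_cases hex : ∃ v, ∀ w, Accepts p π h s w ↔ w = v
  · obtain ⟨v, hv⟩ := hex
    rw [inputs_eq hv, inputs_eq fun w => (hs w).symm.trans (hv w)]
  · have hex' := hex
    simp only [hs] at hex'
    rw [inputs, inputs, dif_neg hex, dif_neg hex']

/-- The claims that `p` signs: the inputs that it accepts and, at time `4 * k`, a vote for its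
vector of inputs. -/
def Signs (p : Party k) (π : PrefList k) (h : History k) : Claim k → Prop
  | .inl (s, v) => Accepts p π h s v
  -- Truncating the history keeps the vote unchanged in later rounds, so a party never votes for two
  -- vectors.
  | .inr V => 4 * k ≤ h.length ∧ V = inputs p π (h.take (4 * k))

/-- The message that `p` sends to everyone: everything received so far and its own signatures. -/
noncomputable def report (p : Party k) (π : PrefList k) (h : History k) : Message (Party k) :=
  .bundle (h.receivedList ++
    (Set.toFinite {c | Signs p π h c}).toFinset.toList.map fun c => .signed p c.toMessage)

theorem mem_sigs_report {p : Party k} {π : PrefList k} {h : History k} {s : Party k}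
    {x : Message (Party k)} : (s, x) ∈ (report p π h).sigs ↔
      (∃ m ∈ h.received, (s, x) ∈ m.sigs) ∨ s = p ∧ ∃ c, Signs p π h c ∧ x = c.toMessage := by
  rw [report, Message.mem_sigs_bundle]
  simp only [List.mem_append, mem_receivedList, or_and_right, exists_or]
  refine or_congr Iff.rfl ?_
  simp only [List.mem_map, Finset.mem_toList, Set.Finite.mem_toFinset, Set.mem_ofPred_eq]
  constructor
  · rintro ⟨_, ⟨c, hc, rfl⟩, hx⟩
    rcases hx with hx | hx
    · exact ⟨(Prod.mk.inj hx).1, c, hc, (Prod.mk.inj hx).2⟩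
    · exact hx.elim
  · rintro ⟨rfl, c, hc, rfl⟩
    exact ⟨_, ⟨c, hc, rfl⟩, Or.inl rfl⟩

/-- The votes for `V` received from the parties of the side `b`. -/
def voters (h : History k) (V : Party k → PrefList k) (b : Bool) : Set (Party k) :=
  {p | p.isLeft = b ∧ p ∈ signers h (.inr V)}

end History

open Classical History in
/-- The protocol: all parties gossip everything for `4 * k + 2` rounds; a party then outputs its
partner in a stable matching with respect to its vector of inputs, provided that sufficiently many
parties of its own side have voted for this vector. -/
noncomputable def matchingProtocol (k tL tR : ℕ) : Protocol k where
  send p π h _ := some (report p π h)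
  -- The two extra rounds let the votes cast at time `4 * k` return to the voter's own side through
  -- the other side.
  output p π h := if h.length = 4 * k + 2 then
      some (if k - (if p.isLeft then tL else tR) ≤
          (voters h (inputs p π (h.take (4 * k))) p.isLeft).ncard then
        some (partner (inputs p π (h.take (4 * k))) p) else none)
    else none
  send_constructible := by
    rintro p π h q m hm ⟨s, x⟩ hx
    obtain rfl := Option.some.inj hm
    rcases mem_sigs_report.mp hx with h | ⟨rfl, -⟩
    · exact Or.inr h
    · exact Or.inl rfl

/-! ### Correctness of the protocol -/

namespace Execution

open History

variable {k tL tR : ℕ} {e : Execution k}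

/-- The vector of inputs according to `p` at time `4 * k`. -/
noncomputable def agreedInputs (e : Execution k) (p : Party k) : Party k → PrefList k :=
  inputs p (e.pref p) (e.view p (4 * k))

theorem mem_signers_view {p q : Party k} {r : ℕ} {c : Claim k} :
    p ∈ signers (e.view q r) c ↔
      ∃ r' < r, ∃ a m, e.sent r' a q = some m ∧ (p, c.toMessage) ∈ m.sigs := by
  simp only [signers, Set.mem_ofPred_eq, mem_received_view]
  constructor
  · rintro ⟨m, ⟨r', h, a, ha⟩, hx⟩
    exact ⟨r', h, a, m, ha, hx⟩
  · rintro ⟨r', h, a, m, ha, hx⟩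
    exact ⟨m, ⟨r', h, a, ha⟩, hx⟩

theorem signers_view_mono (p : Party k) {r r' : ℕ} (h : r ≤ r') (c : Claim k) :
    signers (e.view p r) c ⊆ signers (e.view p r') c := by
  intro s hs
  obtain ⟨i, hi, hs⟩ := mem_signers_view.mp hs
  exact mem_signers_view.mpr ⟨i, hi.trans_le h, hs⟩

theorem accepts_view {p : Party k} {π : PrefList k} {r : ℕ} {s : Party k} {v : PrefList k} :
    Accepts p π (e.view p r) s v ↔ (s = p ∧ v = π) ∨ ∃ r' ≤ r,
      s ∈ signers (e.view p r') (.inl (s, v)) ∧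
        r' ≤ 2 * (signers (e.view p r') (.inl (s, v))).ncard := by
  rw [Accepts, length_view]
  refine or_congr Iff.rfl (exists_congr fun r' => and_congr_right fun h => ?_)
  rw [take_view e p h]

theorem IsRun.mem_signers_of_adj (he : e.IsRun (bipartiteNetwork k) (matchingProtocol k tL tR))
    {u w : Party k} (hu : e.Honest u) (huw : u.isLeft ≠ w.isLeft) {r : ℕ} {c : Claim k} {s : Party k}
    (hs : s ∈ signers (e.view u r) c ∨ s = u ∧ Signs u (e.pref u) (e.view u r) c) :
    s ∈ signers (e.view w (r + 1)) c := by
  have hsent := he.follows r u w (hu r) (bipartiteNetwork_adj.mpr huw)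
  refine mem_signers_view.mpr ⟨r, r.lt_succ_self, u, _, hsent, mem_sigs_report.mpr ?_⟩
  rcases hs with hs | ⟨rfl, hs⟩
  · exact Or.inl hs
  · exact Or.inr ⟨rfl, c, hs, rfl⟩

/-- If both sides have an honest party, then what an honest party knows is known to all honest
parties two rounds later. -/
theorem IsRun.mem_signers_add_two (he : e.IsRun (bipartiteNetwork k) (matchingProtocol k tL tR))
    (hb : ∀ b : Bool, ∃ p : Party k, p.isLeft = b ∧ e.Honest p)
    {u : Party k} (w : Party k) (hu : e.Honest u) {r : ℕ} {c : Claim k} {s : Party k}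
    (hs : s ∈ signers (e.view u r) c ∨ s = u ∧ Signs u (e.pref u) (e.view u r) c) :
    s ∈ signers (e.view w (r + 2)) c := by
  by_cases huw : u.isLeft = w.isLeft
  · obtain ⟨p, hpu, hp⟩ := hb (!u.isLeft)
    have h1 : u.isLeft ≠ p.isLeft := hpu ▸ Bool.self_ne_not _
    exact he.mem_signers_of_adj hp (huw ▸ h1.symm) (Or.inl (he.mem_signers_of_adj hu h1 hs))
  · exact signers_view_mono w (by omega) c (he.mem_signers_of_adj hu huw hs)

/-- Tracing the signature to its origin gives a round in which `p` issued it by its own rule, not by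
forwarding. That `p` had not yet received it back is what rules out circular acceptance of a claim
about itself. -/
theorem IsRun.signs_of_mem_signers
    (he : e.IsRun (bipartiteNetwork k) (matchingProtocol k tL tR))
    {p q : Party k} (hp : e.Honest p) {r : ℕ} {c : Claim k} (h : p ∈ signers (e.view q r) c) :
    ∃ r' < r, Signs p (e.pref p) (e.view p r') c ∧ p ∉ signers (e.view p r') c := by
  obtain ⟨i, hi, a, m, ha, hx⟩ := mem_signers_view.mp h
  obtain ⟨r', hr', q', m', hm', hx', hnew⟩ := he.exists_origin hp _ i a q m ha hx
  have hnew' : p ∉ signers (e.view p r') c := fun ⟨m'', h1, h2⟩ => hnew m'' h1 h2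
  refine ⟨r', hr'.trans_lt hi, ?_, hnew'⟩
  have hadj : (bipartiteNetwork k).Adj p q' := by
    by_contra h
    simp [he.channel r' p q' h] at hm'
  rw [he.follows r' p q' (hp r') hadj] at hm'
  obtain rfl := Option.some.inj hm'
  rcases mem_sigs_report.mp hx' with h | ⟨-, d, hd, hcd⟩
  · exact absurd h hnew'
  · rwa [Claim.toMessage_injective hcd]

theorem IsRun.eq_pref_of_mem_signers
    (he : e.IsRun (bipartiteNetwork k) (matchingProtocol k tL tR))
    {p q : Party k} (hp : e.Honest p) {r : ℕ} {v : PrefList k}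
    (h : p ∈ signers (e.view q r) (.inl (p, v))) : v = e.pref p := by
  obtain ⟨r', -, hs, hnew⟩ := he.signs_of_mem_signers hp h
  rcases accepts_view.mp hs with ⟨-, h⟩ | ⟨r'', hr'', h, -⟩
  · exact h
  · exact absurd (signers_view_mono p hr'' _ h) hnew

theorem IsRun.eq_agreedInputs_of_mem_signers
    (he : e.IsRun (bipartiteNetwork k) (matchingProtocol k tL tR))
    {p q : Party k} (hp : e.Honest p) {r : ℕ} {V : Party k → PrefList k}
    (h : p ∈ signers (e.view q r) (.inr V)) : V = e.agreedInputs p := by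
  obtain ⟨r', -, ⟨hk, hs⟩, -⟩ := he.signs_of_mem_signers hp h
  rw [length_view] at hk
  rwa [take_view e p hk] at hs

theorem IsRun.eq_pref_of_accepts (he : e.IsRun (bipartiteNetwork k) (matchingProtocol k tL tR))
    {s q : Party k} (hs : e.Honest s) {r : ℕ} {v : PrefList k}
    (h : Accepts q (e.pref q) (e.view q r) s v) : v = e.pref s := by
  rcases accepts_view.mp h with ⟨rfl, h⟩ | ⟨r', -, h, -⟩
  · exact h
  · exact he.eq_pref_of_mem_signers hs h

/-- This is the agreement step of the broadcast. At its first acceptance, `u` adds a new signature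
to those it has seen; two rounds later `w` holds them all, so the required number of signatures,
which grows by one in two rounds, is still met. -/
theorem IsRun.accepts_of_accepts (he : e.IsRun (bipartiteNetwork k) (matchingProtocol k tL tR))
    (hb : ∀ b : Bool, ∃ p : Party k, p.isLeft = b ∧ e.Honest p)
    {u w : Party k} (hu : e.Honest u) {s : Party k} {v : PrefList k}
    (h : Accepts u (e.pref u) (e.view u (4 * k)) s v) :
    Accepts w (e.pref w) (e.view w (4 * k)) s v := by
  classical
  have hcard : Nat.card (Party k) = 2 * k := by simp [two_mul]
  have hk : 0 < k := by rcases u with i | i <;> exact i.pos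
  have hex : ∃ r, Accepts u (e.pref u) (e.view u r) s v := ⟨_, h⟩
  have hmin := fun r (hr : r < Nat.find hex) => Nat.find_min hex hr
  have hacc := Nat.find_spec hex
  set r := Nat.find hex
  have hnew : u ∉ signers (e.view u r) (.inl (s, v)) := fun hmem => by
    obtain ⟨r', hr', hs, -⟩ := he.signs_of_mem_signers hu hmem
    exact hmin r' hr' hs
  rw [accepts_view]
  right
  rcases accepts_view.mp hacc with ⟨rfl, rfl⟩ | ⟨r', hr', hs, hle⟩
  -- An honest party signs its own input at time `0`, and that single signature meets the threshold
  -- at time `2`.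
  · have h0 : Signs s (e.pref s) (e.view s 0) (.inl (s, e.pref s)) := Or.inl ⟨rfl, rfl⟩
    have hmem := he.mem_signers_add_two hb w hu (Or.inr ⟨rfl, h0⟩)
    have := (Set.ncard_pos (Set.toFinite _)).mpr ⟨_, hmem⟩
    exact ⟨2, by omega, hmem, Nat.mul_le_mul_left 2 this⟩
  · have hrr : r' = r := hr'.antisymm (by
      by_contra hlt
      exact hmin r' (not_le.mp hlt) (accepts_view.mpr (Or.inr ⟨r', le_rfl, hs, hle⟩)))
    rw [hrr] at hs hle
    have hsub : insert u (signers (e.view u r) (.inl (s, v))) ⊆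
        signers (e.view w (r + 2)) (.inl (s, v)) := by
      rintro p (rfl | hp)
      · exact he.mem_signers_add_two hb w hu (Or.inr ⟨rfl, hacc⟩)
      · exact he.mem_signers_add_two hb w hu (Or.inl hp)
    have hins := Set.ncard_insert_of_notMem hnew (Set.toFinite _)
    have h1 := Set.ncard_le_ncard hsub (Set.toFinite _)
    -- There are only `2 * k` signers, and `u` is a new one; hence `r + 2 ≤ 4 * k` and the deadline
    -- is never missed.
    have h2 := Set.ncard_le_card (insert u (signers (e.view u r) (.inl (s, v))))
    exact ⟨r + 2, by omega, hsub (Or.inr hs), by omega⟩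

theorem IsRun.agreedInputs_eq (he : e.IsRun (bipartiteNetwork k) (matchingProtocol k tL tR))
    (hb : ∀ b : Bool, ∃ p : Party k, p.isLeft = b ∧ e.Honest p)
    {u w : Party k} (hu : e.Honest u) (hw : e.Honest w) : e.agreedInputs u = e.agreedInputs w := by
  have h : ∀ s v, Accepts u (e.pref u) (e.view u (4 * k)) s v ↔
      Accepts w (e.pref w) (e.view w (4 * k)) s v := fun s v =>
    ⟨he.accepts_of_accepts hb hu, he.accepts_of_accepts hb hw⟩
  exact funext fun s => inputs_congr (h s)

theorem IsRun.agreedInputs_apply (he : e.IsRun (bipartiteNetwork k) (matchingProtocol k tL tR))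
    (hb : ∀ b : Bool, ∃ p : Party k, p.isLeft = b ∧ e.Honest p)
    {u s : Party k} (hs : e.Honest s) : e.agreedInputs u s = e.pref s := by
  refine inputs_eq fun v => ⟨he.eq_pref_of_accepts hs, ?_⟩
  rintro rfl
  exact he.accepts_of_accepts hb hs (Or.inl ⟨rfl, rfl⟩)

/-- Party `p` gets enough votes for its vector of inputs. -/
def Confirmed (e : Execution k) (tL tR : ℕ) (p : Party k) : Prop :=
  k - (if p.isLeft then tL else tR) ≤
    (voters (e.view p (4 * k + 2)) (e.agreedInputs p) p.isLeft).ncard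

open Classical in
theorem outputsAt_matchingProtocol {p : Party k} {r : ℕ} {o : Option (Party k)} :
    OutputsAt (matchingProtocol k tL tR) e p r o ↔ r = 4 * k + 2 ∧
      o = if e.Confirmed tL tR p then some (partner (e.agreedInputs p) p) else none := by
  have hout : ∀ r, (matchingProtocol k tL tR).output p (e.pref p) (e.view p r) =
      if r = 4 * k + 2 then
        some (if e.Confirmed tL tR p then some (partner (e.agreedInputs p) p) else none)
      else none := by
    intro r
    by_cases hr : r = 4 * k + 2
    · subst hr
      simp [matchingProtocol, take_view e p (show 4 * k ≤ 4 * k + 2 by omega), Confirmed,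
        agreedInputs]
    · simp [matchingProtocol, hr]
  simp only [OutputsAt, hout]
  constructor
  · rintro ⟨h, -⟩
    split_ifs at h with hr <;> simp_all
  · rintro ⟨rfl, rfl⟩
    exact ⟨by simp, fun r' hr' => if_neg hr'.ne⟩

theorem outputs_matchingProtocol_some {p q : Party k} :
    Outputs (matchingProtocol k tL tR) e p (some q) ↔
      e.Confirmed tL tR p ∧ q = partner (e.agreedInputs p) p := by
  classical
  simp only [Outputs, outputsAt_matchingProtocol, exists_eq_left]
  split_ifs with h <;> simp [h]

theorem ncard_side_eq (b : Bool) : {p : Party k | p.isLeft = b}.ncard = k := by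
  simpa using ncard_side (Set.univ : Set (Party k)) b

theorem Bounded.le_ncard_honest (hbd : e.Bounded tL tR) (b : Bool) :
    k - (if b then tL else tR) ≤ {p : Party k | p.isLeft = b ∧ e.Honest p}.ncard := by
  have h := bounded_iff.mp hbd b
  have hu : {p : Party k | p.isLeft = b} =
      {p | p.isLeft = b ∧ e.Honest p} ∪ {p | p.isLeft = b ∧ ¬ e.Honest p} := by
    ext p
    by_cases hp : e.Honest p <;> simp [hp]
  have h' := Set.ncard_union_le {p : Party k | p.isLeft = b ∧ e.Honest p}
    {p | p.isLeft = b ∧ ¬ e.Honest p}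
  rw [← hu, ncard_side_eq] at h'
  omega

/-- All honest parties of the side of `p`, at least `k` minus the corruption bound, vote at time `4
* k` for the same vector, and their votes arrive two rounds later. -/
theorem IsRun.confirmed (he : e.IsRun (bipartiteNetwork k) (matchingProtocol k tL tR))
    (hbd : e.Bounded tL tR) (hb : ∀ b : Bool, ∃ p : Party k, p.isLeft = b ∧ e.Honest p)
    {p : Party k} (hp : e.Honest p) : e.Confirmed tL tR p := by
  refine (hbd.le_ncard_honest p.isLeft).trans (Set.ncard_le_ncard ?_ (Set.toFinite _))
  rintro q ⟨hq, hq'⟩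
  refine ⟨hq, he.mem_signers_add_two hb p hq' (Or.inr ⟨rfl, by simp, ?_⟩)⟩
  rw [take_view e q le_rfl]
  exact he.agreedInputs_eq hb hp hq'

/-- Two honest parties of a side with fewer than `k / 3` byzantine parties, both confirmed, have the
same vector of inputs, even if all messages between them are dropped. -/
theorem IsRun.agreedInputs_eq_of_confirmed
    (he : e.IsRun (bipartiteNetwork k) (matchingProtocol k tL tR)) (hbd : e.Bounded tL tR)
    {p q : Party k} (hpq : p.isLeft = q.isLeft) (ht : 3 * (if p.isLeft then tL else tR) < k)
    (hp : e.Confirmed tL tR p) (hq : e.Confirmed tL tR q) :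
    e.agreedInputs p = e.agreedInputs q := by
  unfold Confirmed at hp hq
  rw [← hpq] at hq
  have hbad := bounded_iff.mp hbd p.isLeft
  set t := if p.isLeft then tL else tR
  set A := voters (e.view p (4 * k + 2)) (e.agreedInputs p) p.isLeft
  set B := voters (e.view q (4 * k + 2)) (e.agreedInputs q) p.isLeft
  have hunion : (A ∪ B).ncard ≤ k := by
    refine (Set.ncard_le_ncard ?_ (Set.toFinite _)).trans_eq (ncard_side_eq p.isLeft)
    rintro s (hs | hs) <;> exact hs.1
  have hsum := Set.ncard_union_add_ncard_inter A B
  -- Two sets of at least `k - t` voters among `k` parties share at least `k - 2 * t > t` of them,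
  -- hence an honest one.
  obtain ⟨s, ⟨hsA, hsB⟩, hs⟩ : ∃ s ∈ A ∩ B, e.Honest s := by
    by_contra! hcon
    have := Set.ncard_le_ncard (s := A ∩ B) (t := {s | s.isLeft = p.isLeft ∧ ¬ e.Honest s})
      (fun s hs => ⟨hs.1.1, hcon s hs⟩) (Set.toFinite _)
    omega
  rw [he.eq_agreedInputs_of_mem_signers hs hsA.2, he.eq_agreedInputs_of_mem_signers hs hsB.2]

theorem IsRun.isBSM (he : e.IsRun (bipartiteNetwork k) (matchingProtocol k tL tR))
    (hbd : e.Bounded tL tR)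
    (ht : (tL < k ∧ tR < k) ∨ 3 * tL < k ∨ 3 * tR < k) : e.IsBSM (matchingProtocol k tL tR) := by
  classical
  have hterm : ∀ p, e.Honest p → ∃ o, Outputs (matchingProtocol k tL tR) e p o ∧
      ∀ q, o = some q → p.isLeft ≠ q.isLeft := by
    intro p _
    refine ⟨_, ⟨_, outputsAt_matchingProtocol.mpr ⟨rfl, rfl⟩⟩, fun q hq => ?_⟩
    split_ifs at hq
    rw [← Option.some.inj hq]
    exact isLeft_ne_isLeft_partner _ _
  have hcomp : ∀ p p', e.agreedInputs p = e.agreedInputs p' → p ≠ p' →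
      partner (e.agreedInputs p) p ≠ partner (e.agreedInputs p') p' := by
    intro p p' heq hne h
    rw [← heq] at h
    exact hne (by rw [← partner_partner (e.agreedInputs p) p, h, partner_partner])
  by_cases hb : ∀ b : Bool, ∃ p : Party k, p.isLeft = b ∧ e.Honest p
  · refine ⟨hterm, ?_, ?_, ?_⟩
    · intro u v hu hv h
      obtain ⟨-, rfl⟩ := outputs_matchingProtocol_some.mp h
      refine outputs_matchingProtocol_some.mpr ⟨he.confirmed hbd hb hv, ?_⟩
      rw [he.agreedInputs_eq hb hv hu, partner_partner]
    · rintro i j o o' hi hj ⟨r, ho⟩ ⟨r', ho'⟩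
      rw [(outputsAt_matchingProtocol.mp ho).2, (outputsAt_matchingProtocol.mp ho').2,
        if_pos (he.confirmed hbd hb hi), if_pos (he.confirmed hbd hb hj),
        he.agreedInputs_eq hb hj hi, ← he.agreedInputs_apply hb (u := .inl i) hi,
        ← he.agreedInputs_apply hb (u := .inl i) hj]
      exact partner_stable _ i j
    · intro p p' hp hp' hne u v hu hv
      obtain ⟨-, rfl⟩ := outputs_matchingProtocol_some.mp hu
      obtain ⟨-, rfl⟩ := outputs_matchingProtocol_some.mp hv
      exact hcomp p p' (he.agreedInputs_eq hb hp hp') hne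
  -- Side `b` is now entirely byzantine, so its corruption bound is at least `k` and the other bound
  -- must be below `k / 3`.
  · push Not at hb
    obtain ⟨b, hb⟩ := hb
    have hside : ∀ p, e.Honest p → p.isLeft = !b := fun p hp => by
      by_contra h
      exact hb p (by simpa using h) hp
    have hfull : k ≤ if b then tL else tR := by
      have h0 : {p : Party k | p.isLeft = b ∧ e.Honest p} = ∅ :=
        Set.eq_empty_of_forall_notMem fun p hp => hb p hp.1 hp.2
      have := hbd.le_ncard_honest b
      rw [h0, Set.ncard_empty] at this
      omega
    have hthird : 3 * (if !b then tL else tR) < k := by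
      cases b <;> simp at hfull ⊢ <;> omega
    refine ⟨hterm, ?_, ?_, ?_⟩
    · intro u v hu hv h
      obtain ⟨-, rfl⟩ := outputs_matchingProtocol_some.mp h
      exact absurd ((hside _ hu).trans (hside _ hv).symm) (isLeft_ne_isLeft_partner _ _)
    · intro i j o o' hi hj
      simpa using (hside _ hi).trans (hside _ hj).symm
    · intro p p' hp hp' hne u v hu hv
      obtain ⟨hc, rfl⟩ := outputs_matchingProtocol_some.mp hu
      obtain ⟨hc', rfl⟩ := outputs_matchingProtocol_some.mp hv
      refine hcomp p p' (he.agreedInputs_eq_of_confirmed hbd ?_ ?_ hc hc') hne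
      · rw [hside p hp, hside p' hp']
      · rwa [hside p hp]

end Execution

theorem solvableAdaptive {k tL tR : ℕ} (ht : (tL < k ∧ tR < k) ∨ 3 * tL < k ∨ 3 * tR < k) :
    SolvableAdaptive (bipartiteNetwork k) tL tR :=
  ⟨matchingProtocol k tL tR, 4 * k + 2, fun _ he hbd => ⟨he.isBSM hbd ht, fun _ _ =>
    ⟨_, le_rfl, _, Execution.outputsAt_matchingProtocol.mpr ⟨rfl, rfl⟩⟩⟩⟩

/-! ### Impossibility -/

namespace Execution

variable {k : ℕ}

open Classical in
/-- What the parties have received before each round if the parties in `S` are silent and all others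
follow the protocol `P`. -/
noncomputable def silentHistory (P : Protocol k) (pref : Party k → PrefList k) (S : Set (Party k)) :
    ℕ → Party k → History k
  | 0, _ => []
  | r + 1, p => silentHistory P pref S r p ++ [fun q =>
      if q ∉ S ∧ q.isLeft ≠ p.isLeft then P.send q (pref q) (silentHistory P pref S r q) p
      else none]

open Classical in
/-- The run in which the parties in `S` are silent and all others follow the protocol `P`. -/
noncomputable def silentRun (P : Protocol k) (pref : Party k → PrefList k) (S : Set (Party k)) :
    Execution k where
  pref := pref
  byz _ := S
  sent r p q := if p ∉ S ∧ p.isLeft ≠ q.isLeft then P.send p (pref p) (silentHistory P pref S r p) q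
    else none

variable {P : Protocol k} {pref : Party k → PrefList k} {S : Set (Party k)}

theorem view_silentRun (p : Party k) (r : ℕ) :
    (silentRun P pref S).view p r = silentHistory P pref S r p := by
  induction r with
  | zero => rfl
  | succ r ih => rw [silentHistory, ← ih, view, List.range_succ, List.map_append]; rfl

theorem silentRun_sent_of_mem {p : Party k} (hp : p ∈ S) (r : ℕ) (q : Party k) :
    (silentRun P pref S).sent r p q = none := if_neg fun h => h.1 hp

theorem isStaticRun_silentRun : (silentRun P pref S).IsStaticRun (bipartiteNetwork k) P where
  byz_mono := monotone_const
  channel r p q h := if_neg fun h' => h (bipartiteNetwork_adj.mpr h'.2)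
  follows r p q hp hpq := by
    rw [view_silentRun]
    exact if_pos ⟨hp, bipartiteNetwork_adj.mp hpq⟩
  unforgeable r p q m hp h := by simp [silentRun_sent_of_mem (S := S) hp] at h
  byz_const _ := rfl
  unforgeable_static r p q m hp h := by simp [silentRun_sent_of_mem (S := S) hp] at h

theorem honest_silentRun {p : Party k} : (silentRun P pref S).Honest p ↔ p ∉ S :=
  ⟨fun h => h 0, fun h _ => h⟩

/-- If a party sends somebody else's signature, then the signer is not silent and has sent it
before. -/
theorem silentRun_signature {s : Party k} {x : Message (Party k)} (r : ℕ) :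
    ∀ p q m, (silentRun P pref S).sent r p q = some m → (s, x) ∈ m.sigs →
      s ∉ S ∧ (s ≠ p → ∃ r' < r, ∃ q' m', (silentRun P pref S).sent r' s q' = some m' ∧
        (s, x) ∈ m'.sigs) := by
  induction r using Nat.strong_induction_on with
  | _ r ih =>
    intro p q m hm hx
    have hrun := (isStaticRun_silentRun (P := P) (pref := pref) (S := S)).toIsRun
    have hp : p ∉ S := fun hp => by simp [silentRun_sent_of_mem hp] at hm
    have hpq : (bipartiteNetwork k).Adj p q := by
      by_contra h
      simp [hrun.channel r p q h] at hm
    rw [hrun.follows r p q hp hpq] at hm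
    rcases P.send_constructible _ _ _ _ _ hm _ hx with h | ⟨m', hm', hx'⟩
    · obtain rfl : s = p := h
      exact ⟨hp, fun h => absurd rfl h⟩
    · obtain ⟨r', hr', q', hq'⟩ := mem_received_view.mp hm'
      obtain ⟨hs, horig⟩ := ih r' hr' q' p m' hq' hx'
      refine ⟨hs, fun _ => ?_⟩
      by_cases hsq : s = q'
      · subst hsq
        exact ⟨r', hr', p, m', hq', hx'⟩
      · obtain ⟨r'', hr'', h⟩ := horig hsq
        exact ⟨r'', hr''.trans hr', h⟩

open Classical in
/-- The run in which all parties outside `A ∪ B` are byzantine and behave towards `A` as in the run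
in which `B` is silent, and towards `B` as in the run in which `A` is silent. -/
noncomputable def splitRun (P : Protocol k) (prefA prefB : Party k → PrefList k)
    (A B : Set (Party k)) : Execution k where
  pref p := if p ∈ A then prefA p else prefB p
  byz _ := (A ∪ B)ᶜ
  sent r p q :=
    if p ∈ A ∨ q ∈ A then (silentRun P prefA B).sent r p q
    else if p ∈ B ∨ q ∈ B then (silentRun P prefB A).sent r p q
    else none

variable {prefA prefB : Party k → PrefList k} {A B : Set (Party k)} {b : Bool}

theorem splitRun_sent_left {p q : Party k} (h : p ∈ A ∨ q ∈ A) (r : ℕ) :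
    (splitRun P prefA prefB A B).sent r p q = (silentRun P prefA B).sent r p q := if_pos h

theorem splitRun_sent_right (hAB : Disjoint A B) (hside : ∀ p ∈ A ∪ B, p.isLeft = b)
    {p q : Party k} (h : p ∈ B ∨ q ∈ B) (r : ℕ) :
    (splitRun P prefA prefB A B).sent r p q = (silentRun P prefB A).sent r p q := by
  -- The two rules of the split run overlap only when one endpoint lies in `A` and the other in `B`;
  -- these are on the same side, where no message passes in either world.
  by_cases hA : p ∈ A ∨ q ∈ A
  · rw [splitRun_sent_left hA]
    have hpq : p.isLeft = q.isLeft := by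
      rcases h with h | h <;> rcases hA with h' | h'
      · exact (Set.disjoint_left.mp hAB h' h).elim
      · rw [hside p (Or.inr h), hside q (Or.inl h')]
      · rw [hside p (Or.inl h'), hside q (Or.inr h)]
      · exact (Set.disjoint_left.mp hAB h' h).elim
    have hadj : ¬ (bipartiteNetwork k).Adj p q := fun h => bipartiteNetwork_adj.mp h hpq
    rw [isStaticRun_silentRun.channel r p q hadj, isStaticRun_silentRun.channel r p q hadj]
  · exact (if_neg hA).trans (if_pos h)

theorem view_splitRun_left {p : Party k} (hp : p ∈ A) (r : ℕ) :
    (splitRun P prefA prefB A B).view p r = (silentRun P prefA B).view p r := by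
  simp only [view, splitRun_sent_left (Or.inr hp)]

theorem view_splitRun_right (hAB : Disjoint A B) (hside : ∀ p ∈ A ∪ B, p.isLeft = b)
    {p : Party k} (hp : p ∈ B) (r : ℕ) :
    (splitRun P prefA prefB A B).view p r = (silentRun P prefB A).view p r := by
  simp only [view, splitRun_sent_right hAB hside (Or.inr hp)]

/-- The point is unforgeability. A simulated message to `A` carries no signature from the silent
`B`. A signature from `A` was sent earlier by its owner in that world, hence also in the split run,
and to the opposite side, which is wholly byzantine. The same holds with `A` and `B` exchanged. -/
theorem isStaticRun_splitRun (hAB : Disjoint A B) (hside : ∀ p ∈ A ∪ B, p.isLeft = b) :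
    (splitRun P prefA prefB A B).IsStaticRun (bipartiteNetwork k) P := by
  set e := splitRun P prefA prefB A B
  have hother : ∀ p q, p ∈ A ∪ B → (bipartiteNetwork k).Adj p q → q ∈ (A ∪ B)ᶜ := by
    intro p q hp hpq hq
    exact bipartiteNetwork_adj.mp hpq ((hside p hp).trans (hside q hq).symm)
  have hforge : ∀ (pref : Party k → PrefList k) (S T : Set (Party k)), S ∪ T = A ∪ B →
      (∀ r, ∀ p ∈ S, ∀ q, e.sent r p q = (silentRun P pref T).sent r p q) →
      ∀ r p q m, p ∈ (A ∪ B)ᶜ → (silentRun P pref T).sent r p q = some m →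
        m.Constructible (A ∪ B)ᶜ (e.receivedByByz r) := by
    rintro pref S T hST hsent r p q m hp hm ⟨s, x⟩ hx
    obtain ⟨hsT, horig⟩ := silentRun_signature r p q m hm hx
    by_cases hs : s ∈ A ∪ B
    · have hsS : s ∈ S := by
        rw [← hST] at hs
        exact hs.resolve_right hsT
      obtain ⟨r', hr', q', m', hm', hx'⟩ := horig (by rintro rfl; exact hp hs)
      have hadj : (bipartiteNetwork k).Adj s q' := by
        by_contra h
        simp [isStaticRun_silentRun.channel r' s q' h] at hm'
      rw [← hsent r' s hsS q'] at hm'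
      exact Or.inr ⟨m', ⟨r', hr', s, fun h => h hs, q', hother s q' hs hadj, hm'⟩, hx'⟩
    · exact Or.inl hs
  have hstatic : ∀ r p q m, p ∈ e.byz r → e.sent r p q = some m →
      m.Constructible (e.byz r) (e.receivedByByz r) := by
    intro r p q m hp hm
    have hp' : p ∉ A ∪ B := hp
    by_cases hqA : q ∈ A
    · rw [splitRun_sent_left (Or.inr hqA)] at hm
      exact hforge prefA A B rfl (fun r p hp q => splitRun_sent_left (Or.inl hp) r) r p q m hp hm
    by_cases hqB : q ∈ B
    · rw [splitRun_sent_right hAB hside (Or.inr hqB)] at hm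
      exact hforge prefB B A (Set.union_comm B A)
        (fun r p hp q => splitRun_sent_right hAB hside (Or.inl hp) r) r p q m hp hm
    · rw [Set.mem_union, not_or] at hp'
      simp [e, splitRun, hp'.1, hp'.2, hqA, hqB] at hm
  refine ⟨⟨monotone_const, ?_, ?_, ?_⟩, fun _ => rfl, hstatic⟩
  · intro r p q h
    simp only [e, splitRun, isStaticRun_silentRun.channel r p q h, ite_self]
  · intro r p q hp hpq
    have hp' : p ∈ A ∪ B := by simpa [e, splitRun, or_iff_not_imp_left] using hp
    rcases hp' with hpA | hpB
    · have hpB : p ∉ B := Set.disjoint_left.mp hAB hpA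
      rw [splitRun_sent_left (Or.inl hpA), view_splitRun_left hpA,
        isStaticRun_silentRun.follows r p q hpB hpq]
      simp [e, splitRun, silentRun, hpA]
    · have hpA : p ∉ A := Set.disjoint_right.mp hAB hpB
      rw [splitRun_sent_right hAB hside (Or.inl hpB), view_splitRun_right hAB hside hpB,
        isStaticRun_silentRun.follows r p q hpA hpq]
      simp [e, splitRun, silentRun, hpA]
  · intro r p q m hp hm s hs
    refine (hstatic r p q m hp hm s hs).imp_right ?_
    rintro ⟨m', ⟨r', hr', a, ha, c, -, h⟩, hx⟩
    exact ⟨m', ⟨r', hr'.le, a, ha, c, h⟩, hx⟩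

theorem honest_splitRun {p : Party k} : (splitRun P prefA prefB A B).Honest p ↔ p ∈ A ∪ B :=
  ⟨fun h => not_not.mp (h 0), fun h _ h' => h' h⟩

/-- Honest parties that are each other's first choices are matched. -/
theorem IsBSM.outputs_of_top {e : Execution k} (he : e.IsBSM P) {u v : Party k}
    (huv : u.isLeft ≠ v.isLeft) (hu : e.Honest u) (hv : e.Honest v)
    (huTop : ∀ i ≠ v.idx, (e.pref u).symm v.idx < (e.pref u).symm i)
    (hvTop : ∀ i ≠ u.idx, (e.pref v).symm u.idx < (e.pref v).symm i) :
    Outputs P e u (some v) := by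
  have key : ∀ {a c : Party k}, a.isLeft ≠ c.isLeft →
      (∀ i ≠ c.idx, (e.pref a).symm c.idx < (e.pref a).symm i) → ∀ o : Option (Party k),
      (∀ q, o = some q → a.isLeft ≠ q.isLeft) → o ≠ some c → (e.pref a).Prefers c o := by
    intro a c hac htop o ho hne
    cases o with
    | none => trivial
    | some q =>
      refine htop _ fun hidx => hne (congrArg some (Party.eq_of_side_of_idx ?_ hidx))
      rw [Bool.eq_not_of_ne hac.symm, Bool.eq_not_of_ne (ho q rfl).symm]
  obtain ⟨o, ho, hoside⟩ := he.termination u hu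
  obtain ⟨o', ho', ho'side⟩ := he.termination v hv
  by_contra hcon
  refine he.stable huv hu hv ho ho' ⟨key huv huTop o hoside ?_, key huv.symm hvTop o' ho'side ?_⟩
  · rintro rfl
    exact hcon ho
  · rintro rfl
    exact hcon (he.symmetry v u hv hu ho')

end Execution

-- The flag `b` selects the side that contains the two deceived groups; the other side is entirely
-- corrupted in the split run.
open Execution in
theorem not_solvableStatic_of_side {k tL tR : ℕ} (hk : 2 ≤ k) (b : Bool)
    (hb : k ≤ 3 * if b then tL else tR) (hb' : k ≤ if b then tR else tL) :
    ¬ SolvableStatic (bipartiteNetwork k) tL tR := by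
  obtain ⟨k, rfl⟩ := Nat.exists_eq_add_of_le' hk
  rintro ⟨P, hP⟩
  let side : Bool → Fin (k + 2) → Party (k + 2) := fun c i => if c then .inl i else .inr i
  have side_isLeft : ∀ c i, (side c i).isLeft = c := fun c i => by cases c <;> rfl
  have side_idx : ∀ c i, (side c i).idx = i := fun c i => by cases c <;> rfl
  -- Residues modulo `3` give three groups, each small enough to be corrupted: within a group, `idx
  -- / 3` is injective with values below the corruption bound.
  let group : ℕ → Set (Party (k + 2)) := fun c => {p | p.isLeft = b ∧ (p.idx : ℕ) % 3 = c}
  have hgroup : ∀ c, (group c).ncard ≤ if b then tL else tR := by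
    intro c
    have h := Set.ncard_le_ncard_of_injOn (s := group c)
      (t := (Finset.range (if b then tL else tR) : Set ℕ)) (fun p => (p.idx : ℕ) / 3)
      (fun p _ => by
        simp only [Finset.coe_range, Set.mem_Iio]
        have := p.idx.is_lt
        omega)
      (fun p hp q hq hpq => Party.eq_of_side_of_idx (hp.1.trans hq.1.symm) (Fin.ext (by
        have h1 := hp.2
        have h2 := hq.2
        simp only at hpq
        omega)))
    rwa [Set.ncard_coe_finset, Finset.card_range] at h
  have hdisj : Disjoint (group 0) (group 1) := by
    rw [Set.disjoint_left]
    rintro p ⟨-, h⟩ ⟨-, h'⟩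
    omega
  have hside : ∀ p ∈ group 0 ∪ group 1, p.isLeft = b := by rintro p (h | h) <;> exact h.1
  have hsilent : ∀ pref c, (silentRun P pref (group c)).IsBSM P := by
    intro pref c
    refine hP _ isStaticRun_silentRun (bounded_iff.mpr fun b' => ?_)
    simp only [honest_silentRun, not_not]
    by_cases hbb : b' = b
    · subst hbb
      exact (Set.ncard_le_ncard (fun p hp => hp.2) (Set.toFinite _)).trans (hgroup c)
    · have : {p : Party (k + 2) | p.isLeft = b' ∧ p ∈ group c} = ∅ :=
        Set.eq_empty_of_forall_notMem fun p hp => hbb (hp.1.symm.trans hp.2.1)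
      simp [this]
  let u₀ := side b 0
  let u₁ := side b 1
  let v := side (!b) 0
  -- Both `u₀` and `u₁` rank `v` first; `v` ranks `u₀` first under `prefA` and `u₁` first under
  -- `prefB`.
  let prefA : Party (k + 2) → PrefList (k + 2) := fun _ => Equiv.refl _
  let prefB : Party (k + 2) → PrefList (k + 2) := fun p =>
    if p.isLeft = b then Equiv.refl _ else Equiv.swap 0 1
  have hsplit : (splitRun P prefA prefB (group 0) (group 1)).IsBSM P := by
    refine hP _ (isStaticRun_splitRun hdisj hside) (bounded_iff.mpr fun b' => ?_)
    simp only [honest_splitRun]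
    by_cases hbb : b' = b
    · subst hbb
      refine (Set.ncard_le_ncard ?_ (Set.toFinite _)).trans (hgroup 2)
      rintro p ⟨hp, hp'⟩
      simp only [group, Set.mem_union, Set.mem_ofPred_eq, hp, true_and] at hp' ⊢
      omega
    · refine (Set.ncard_le_ncard (fun p hp => hp.1) (Set.toFinite _)).trans
        ((ncard_side_eq b').trans_le ?_)
      rw [Bool.eq_not_of_ne hbb]
      cases b <;> exact hb'
  have hu₀ : u₀ ∈ group 0 := ⟨side_isLeft _ _, by rw [side_idx, Fin.val_zero]⟩
  have hu₁ : u₁ ∈ group 1 := ⟨side_isLeft _ _, by rw [side_idx, Fin.val_one]⟩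
  have hv : ∀ c, v ∉ group c := fun c h => Bool.self_ne_not b (h.1.symm.trans (side_isLeft _ _))
  have hne : ∀ i, (side b i).isLeft ≠ v.isLeft := fun i => by
    rw [side_isLeft, side_isLeft]
    exact Bool.self_ne_not b
  have hpos : ∀ i : Fin (k + 2), i ≠ 0 → 0 < i := fun i hi => Fin.pos_iff_ne_zero.mpr hi
  have out₀ : Outputs P (silentRun P prefA (group 1)) u₀ (some v) := by
    refine (hsilent prefA 1).outputs_of_top (hne 0)
      (honest_silentRun.mpr (Set.disjoint_left.mp hdisj hu₀)) (honest_silentRun.mpr (hv 1)) ?_ ?_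
    · simpa [silentRun, prefA, v, side_idx] using hpos
    · simpa [silentRun, prefA, u₀, side_idx] using hpos
  have out₁ : Outputs P (silentRun P prefB (group 0)) u₁ (some v) := by
    refine (hsilent prefB 0).outputs_of_top (hne 1)
      (honest_silentRun.mpr (Set.disjoint_right.mp hdisj hu₁)) (honest_silentRun.mpr (hv 0)) ?_ ?_
    · simpa [silentRun, prefB, u₁, v, side_idx, side_isLeft] using hpos
    · have hswap : ∀ i : Fin (k + 2), i ≠ 1 → 0 < Equiv.swap 0 1 i := fun i hi =>
        hpos _ fun h => hi (by rwa [Equiv.swap_apply_eq_iff, Equiv.swap_apply_left] at h)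
      simpa [silentRun, prefB, u₁, v, side_idx, side_isLeft] using hswap
  refine hsplit.nonCompetition u₀ u₁ (honest_splitRun.mpr (Or.inl hu₀))
    (honest_splitRun.mpr (Or.inr hu₁)) ?_ v v ?_ ?_ rfl
  · intro h
    exact Set.disjoint_left.mp hdisj hu₀ (h ▸ hu₁)
  · exact outputs_congr (by simp [splitRun, silentRun, hu₀])
      (fun r => (view_splitRun_left hu₀ r).symm) out₀
  · exact outputs_congr (by simp [splitRun, silentRun, Set.disjoint_right.mp hdisj hu₁])
      (fun r => (view_splitRun_right hdisj hside hu₁ r).symm) out₁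

theorem mainTheorem4 (k tL tR : ℕ) :
    (((tL < k ∧ tR < k) ∨ ((tL : ℚ) < (k : ℚ) / 3 ∨ (tR : ℚ) < (k : ℚ) / 3)) →
      SolvableAdaptive (completeBipartiteGraph (Fin k) (Fin k)) tL tR) ∧
    (2 ≤ k → SolvableStatic (completeBipartiteGraph (Fin k) (Fin k)) tL tR →
      ((tL < k ∧ tR < k) ∨ ((tL : ℚ) < (k : ℚ) / 3 ∨ (tR : ℚ) < (k : ℚ) / 3))) := by
  have hdiv : ∀ t : ℕ, (t : ℚ) < (k : ℚ) / 3 ↔ 3 * t < k := fun t => by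
    rw [lt_div_iff₀ (by norm_num), mul_comm]
    exact_mod_cast Iff.rfl
  rw [hdiv, hdiv]
  refine ⟨solvableAdaptive, fun hk hsolv => ?_⟩
  by_contra hcon
  -- If the condition fails, one side can be corrupted entirely, and both bounds are at least `k /
  -- 3`.
  by_cases htR : k ≤ tR
  · exact not_solvableStatic_of_side hk true (by simp only [if_true]; omega) htR hsolv
  · exact not_solvableStatic_of_side hk false (by simp; omega) (by simp; omega) hsolv
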